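/- Let $\mathbb K$ be $\mathbb R$ or $\mathbb C$, let $E,F$ be normed spaces over $\mathbb K$ (not necessarily complete), and write $E',E''$ for the topological dual and bidual of $E$. For normed spaces $X,Y$ and a continuous bilinear form $\chi$ on $X\times Y$, the canonical right extension $\chi^\wedge$ is the continuous bilinear form on $X\times Y''$ given by $\chi^\wedge(x,y'')=\langle y'',\chi(x,\cdot)\rangle$, and the canonical left extension ${}^\wedge\chi$ is the continuous bilinear form on $X''\times Y$ given by ${}^\wedge\chi(x'',y)=\langle x'',\chi(\cdot,y)\rangle$. Let $\varphi:E\times F\to\mathbb K$ be a continuous bilinear form, and let $L_\varphi:E\to F'$, $\langle L_\varphi x,y\rangle=\varphi(x,y)$, be the associated bounded operator. Then the following are equivalent: (a) The two canonical extensions $({}^\wedge\varphi)^\wedge$ and ${}^\wedge(\varphi^\wedge)$ of $\varphi$ to $E''\times F''$ coincide. (b) There is a continuous bilinear form $\psi$ on $E''\times F''$ that extends $\varphi$ (along the canonical embeddings $E\hookrightarrow E''$, $F\hookrightarrow F''$) and is separately weak*-continuous: $\psi(\cdot,y'')$ is $\sigma(E'',E')$-continuous for every $y''\in F''$, and $\psi(x'',\cdot)$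 is $\sigma(F'',F')$-continuous for every $x''\in E''$. (c) $L_\varphi$ is weakly compact, i.e. the image under $L_\varphi$ of the closed unit ball of $E$ is relatively compact in $F'$ for the weak topology $\sigma(F',F'')$. In this case, every $\psi$ as in (b) satisfies $\psi=({}^\wedge\varphi)^\wedge={}^\wedge(\varphi^\wedge)$. -/

import Mathlib

set_option maxSynthPendingDepth 3

/-! Continuous bilinear forms on `E × F` are, as usual in Mathlib, the elements of
`E →L[𝕜] F →L[𝕜] 𝕜`; the topological dual of `E` is `StrongDual 𝕜 E`, with the operator norm. -/

namespace ArensExt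

variable {𝕜 : Type*} [RCLike 𝕜]
variable {E : Type*} [NormedAddCommGroup E] [NormedSpace 𝕜 E]
variable {F : Type*} [NormedAddCommGroup F] [NormedSpace 𝕜 F]

/-- The operator `L_φ : E → F'` associated with the bilinear form `φ`, that is
`⟨L_φ x, y⟩ = φ (x, y)`. -/
noncomputable def assocOperator (φ : E →L[𝕜] F →L[𝕜] 𝕜) : E →L[𝕜] StrongDual 𝕜 F := φ

/-- The transpose (dual operator) `T' : G' → E'`, `T' g = g ∘ T`, of a bounded operator `T`. -/
noncomputable def dualOperator {G : Type*} [NormedAddCommGroup G] [NormedSpace 𝕜 G]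
    (T : E →L[𝕜] G) : StrongDual 𝕜 G →L[𝕜] StrongDual 𝕜 E :=
  ContinuousLinearMap.precomp 𝕜 T

/-- The canonical right extension of `φ` to `E × F''`, that is
`(x, y'') ↦ ⟨L_φ' y'', x⟩ = ⟨y'', φ (x, ·)⟩`. -/
noncomputable def rightExt (φ : E →L[𝕜] F →L[𝕜] 𝕜) :
    E →L[𝕜] StrongDual 𝕜 (StrongDual 𝕜 F) →L[𝕜] 𝕜 :=
  (dualOperator (assocOperator φ)).flip

/-- The canonical left extension of `φ` to `E'' × F`: the transposed right extension of the
transposed form, that is `(x'', y) ↦ ⟨x'', φ (·, y)⟩`. -/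
noncomputable def leftExt (φ : E →L[𝕜] F →L[𝕜] 𝕜) :
    StrongDual 𝕜 (StrongDual 𝕜 E) →L[𝕜] F →L[𝕜] 𝕜 :=
  (rightExt φ.flip).flip

theorem rightExt_apply (φ : E →L[𝕜] F →L[𝕜] 𝕜) (x : E) (y'' : StrongDual 𝕜 (StrongDual 𝕜 F)) :
    rightExt φ x y'' = y'' (φ x) := rfl

theorem leftExt_apply (φ : E →L[𝕜] F →L[𝕜] 𝕜) (x'' : StrongDual 𝕜 (StrongDual 𝕜 E)) (y : F) :
    leftExt φ x'' y = x'' (φ.flip y) := rfl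

/-- `ψ`, a form on `E'' × F''`, extends `φ` along the canonical embeddings `E → E''`, `F → F''`. -/
def Extends (ψ : StrongDual 𝕜 (StrongDual 𝕜 E) →L[𝕜] StrongDual 𝕜 (StrongDual 𝕜 F) →L[𝕜] 𝕜)
    (φ : E →L[𝕜] F →L[𝕜] 𝕜) : Prop :=
  ∀ (x : E) (y : F), ψ (NormedSpace.inclusionInDoubleDual 𝕜 E x)
    (NormedSpace.inclusionInDoubleDual 𝕜 F y) = φ x y

/-- `ψ` is separately `σ(E'', E')`-`σ(F'', F')`-continuous: each of its two partial functionals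
is continuous for the weak-star topology. -/
def SeparatelyWeakStarContinuous
    (ψ : StrongDual 𝕜 (StrongDual 𝕜 E) →L[𝕜] StrongDual 𝕜 (StrongDual 𝕜 F) →L[𝕜] 𝕜) : Prop :=
  (∀ y'' : StrongDual 𝕜 (StrongDual 𝕜 F),
    Continuous fun x'' : WeakDual 𝕜 (StrongDual 𝕜 E) => ψ (WeakDual.toStrongDual x'') y'') ∧
  (∀ x'' : StrongDual 𝕜 (StrongDual 𝕜 E),
    Continuous fun y'' : WeakDual 𝕜 (StrongDual 𝕜 F) => ψ x'' (WeakDual.toStrongDual y''))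

/-- A bounded operator is weakly compact if the image of the closed unit ball is relatively
compact for the weak topology of the target. -/
def IsWeaklyCompactOperator {G : Type*} [NormedAddCommGroup G] [NormedSpace 𝕜 G]
    (T : E →L[𝕜] G) : Prop :=
  IsCompact (closure ((fun x => toWeakSpace 𝕜 G (T x)) '' Metric.closedBall (0 : E) 1))

end ArensExt

open Metric

namespace ArensExt

variable {𝕜 : Type*} [RCLike 𝕜]
variable {E : Type*} [NormedAddCommGroup E] [NormedSpace 𝕜 E]
variable {F : Type*} [NormedAddCommGroup F] [NormedSpace 𝕜 F]

/-! Write `L` for `assocOperator φ`. The two iterated extensions are `⟨x'', L' y''⟩` and `⟨y'',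
leftExt φ x''⟩`; the first is always weak-star continuous in `x''`, the second in `y''`. They agree
exactly when each `L'' x''` is evaluation at a point of `F'`, which is Gantmacher's criterion for
weak compactness: one direction is Banach–Alaoglu, the other Goldstine. Uniqueness holds because
weak-star continuous functionals are evaluations. -/

/-- A weak-star continuous functional on a dual space is the evaluation at a point. -/
theorem exists_eval_of_weakStar_continuous (f : StrongDual 𝕜 E →L[𝕜] 𝕜)
    (hf : Continuous fun x' : WeakDual 𝕜 E => f (WeakDual.toStrongDual x')) :
    ∃ x : E, ∀ x' : StrongDual 𝕜 E, f x' = x' x := by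
  let g : StrongDual 𝕜 (WeakBilin (topDualPairing 𝕜 E)) :=
    { toLinearMap := f.toLinearMap ∘ₗ (WeakDual.toStrongDual (𝕜 := 𝕜) (E := E)).toLinearMap
      cont := hf }
  obtain ⟨x, hx⟩ := LinearMap.dualEmbedding_surjective (topDualPairing 𝕜 E) g
  exact ⟨x, fun x' => (DFunLike.congr_fun hx x').symm⟩

/-- A functional is bounded in norm by any bound for its real part on the closed unit ball. -/
theorem norm_le_of_re_le {f : StrongDual 𝕜 E} {u : ℝ} (hu : 0 ≤ u)
    (h : ∀ x ∈ closedBall (0 : E) 1, RCLike.re (f x) ≤ u) : ‖f‖ ≤ u := by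
  let _ : NormedSpace ℝ E := NormedSpace.restrictScalars ℝ 𝕜 E
  refine ContinuousLinearMap.opNorm_le_of_unit_norm hu fun x hx => ?_
  -- Rotating `x` by a unimodular scalar makes `f x` equal to its norm.
  obtain ⟨c, hc, hcf⟩ := RCLike.exists_norm_eq_mul_self (f x)
  have hmem : c • x ∈ closedBall (0 : E) 1 := by
    simp [norm_smul, hc, hx]
  have := h _ hmem
  rwa [map_smul, smul_eq_mul, ← hcf, RCLike.ofReal_re] at this

/-- **Goldstine's theorem**: the unit ball of `E` is weak-star dense in the unit ball of `E''`. -/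
theorem mem_closure_image_closedBall {x'' : StrongDual 𝕜 (StrongDual 𝕜 E)} (hx'' : ‖x''‖ ≤ 1) :
    StrongDual.toWeakDual x'' ∈
      closure ((fun x => StrongDual.toWeakDual (NormedSpace.inclusionInDoubleDual 𝕜 E x)) ''
        closedBall (0 : E) 1) := by
  let _ : NormedSpace ℝ E := NormedSpace.restrictScalars ℝ 𝕜 E
  have : IsScalarTower ℝ 𝕜 E := RestrictScalars.isScalarTower ℝ 𝕜 E
  have : LocallyConvexSpace ℝ (WeakDual 𝕜 (StrongDual 𝕜 E)) :=
    inferInstanceAs (LocallyConvexSpace ℝ (WeakBilin (topDualPairing 𝕜 (StrongDual 𝕜 E))))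
  have hconv : Convex ℝ ((fun x => StrongDual.toWeakDual
      (NormedSpace.inclusionInDoubleDual 𝕜 E x)) '' closedBall (0 : E) 1) :=
    (convex_closedBall (0 : E) 1).is_linear_image
      (((StrongDual.toWeakDual (𝕜 := 𝕜) (E := StrongDual 𝕜 E)).toLinearMap ∘ₗ
        (NormedSpace.inclusionInDoubleDual 𝕜 E).toLinearMap).restrictScalars ℝ).isLinear
  by_contra hx
  obtain ⟨f, u, hf, hu⟩ := RCLike.geometric_hahn_banach_closed_point (𝕜 := 𝕜)
    hconv.closure isClosed_closure hx
  obtain ⟨g, hg⟩ := LinearMap.dualEmbedding_surjective (topDualPairing 𝕜 (StrongDual 𝕜 E)) f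
  have hg' (z : StrongDual 𝕜 (StrongDual 𝕜 E)) : f (StrongDual.toWeakDual z) = z g :=
    (DFunLike.congr_fun hg z).symm
  have hre : ∀ x ∈ closedBall (0 : E) 1, RCLike.re (g x) ≤ u := fun x hx => by
    have := hf _ (subset_closure ⟨x, hx, rfl⟩)
    rw [hg', NormedSpace.dual_def] at this
    exact this.le
  have hu0 : 0 ≤ u := by simpa using hre 0 (by simp)
  rw [hg'] at hu
  have := calc RCLike.re (x'' g) ≤ ‖x'' g‖ := RCLike.re_le_norm _
    _ ≤ ‖x''‖ * ‖g‖ := x''.le_opNorm g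
    _ ≤ 1 * u := mul_le_mul hx'' (norm_le_of_re_le hu0 hre) (norm_nonneg _) zero_le_one
  linarith

theorem leftExt_rightExt_apply (φ : E →L[𝕜] F →L[𝕜] 𝕜) (x'' : StrongDual 𝕜 (StrongDual 𝕜 E))
    (y'' : StrongDual 𝕜 (StrongDual 𝕜 F)) :
    leftExt (rightExt φ) x'' y'' = x'' (dualOperator (assocOperator φ) y'') := rfl

theorem rightExt_leftExt_apply (φ : E →L[𝕜] F →L[𝕜] 𝕜) (x'' : StrongDual 𝕜 (StrongDual 𝕜 E))
    (y'' : StrongDual 𝕜 (StrongDual 𝕜 F)) :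
    rightExt (leftExt φ) x'' y'' = y'' (leftExt φ x'') := rfl

theorem extends_rightExt_leftExt (φ : E →L[𝕜] F →L[𝕜] 𝕜) : Extends (rightExt (leftExt φ)) φ :=
  fun _ _ => rfl

/-- A separately weak-star continuous extension is the left extension of the right extension. -/
theorem eq_leftExt_rightExt {φ : E →L[𝕜] F →L[𝕜] 𝕜}
    {ψ : StrongDual 𝕜 (StrongDual 𝕜 E) →L[𝕜] StrongDual 𝕜 (StrongDual 𝕜 F) →L[𝕜] 𝕜}
    (hψ : SeparatelyWeakStarContinuous ψ) (hext : Extends ψ φ) :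
    ψ = leftExt (rightExt φ) := by
  ext x'' y''
  obtain ⟨x', hx'⟩ := exists_eval_of_weakStar_continuous (ψ.flip y'') (hψ.1 y'')
  have hx'φ : x' = dualOperator (assocOperator φ) y'' := by
    ext x
    obtain ⟨y', hy'⟩ := exists_eval_of_weakStar_continuous
      (ψ (NormedSpace.inclusionInDoubleDual 𝕜 E x)) (hψ.2 _)
    have hy'φ : y' = φ x := by
      ext y
      exact (hy' (NormedSpace.inclusionInDoubleDual 𝕜 F y)).symm.trans (hext x y)
    have := (hx' (NormedSpace.inclusionInDoubleDual 𝕜 E x)).symm.trans (hy' y'')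
    rwa [hy'φ] at this
  rw [leftExt_rightExt_apply, ← hx'φ]
  exact hx' x''

/-- A separately weak-star continuous extension is the right extension of the left extension. -/
theorem eq_rightExt_leftExt {φ : E →L[𝕜] F →L[𝕜] 𝕜}
    {ψ : StrongDual 𝕜 (StrongDual 𝕜 E) →L[𝕜] StrongDual 𝕜 (StrongDual 𝕜 F) →L[𝕜] 𝕜}
    (hψ : SeparatelyWeakStarContinuous ψ) (hext : Extends ψ φ) :
    ψ = rightExt (leftExt φ) := by
  -- Transposition exchanges the two iterated extensions.
  have h : ψ.flip = leftExt (rightExt φ.flip) :=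
    eq_leftExt_rightExt ⟨hψ.2, hψ.1⟩ fun y x => hext x y
  ext x'' y''
  exact DFunLike.congr_fun (DFunLike.congr_fun h y'') x''

theorem separatelyWeakStarContinuous_rightExt_leftExt {φ : E →L[𝕜] F →L[𝕜] 𝕜}
    (h : rightExt (leftExt φ) = leftExt (rightExt φ)) :
    SeparatelyWeakStarContinuous (rightExt (leftExt φ)) := by
  refine ⟨fun y'' => ?_, fun x'' => WeakDual.eval_continuous (leftExt φ x'')⟩
  rw [h]
  exact WeakDual.eval_continuous (dualOperator (assocOperator φ) y'')

/-- Equality makes `leftExt φ` weak-star-to-weak continuous, so it sends the weak-star compact ball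
of `E''` to a weakly compact set containing the image of the ball of `E`. -/
theorem isWeaklyCompactOperator_of_ext_eq {φ : E →L[𝕜] F →L[𝕜] 𝕜}
    (h : rightExt (leftExt φ) = leftExt (rightExt φ)) :
    IsWeaklyCompactOperator (assocOperator φ) := by
  have hcont : Continuous fun x'' : WeakDual 𝕜 (StrongDual 𝕜 E) =>
      toWeakSpace 𝕜 (StrongDual 𝕜 F) (leftExt φ (WeakDual.toStrongDual x'')) :=
    WeakBilin.continuous_of_continuous_eval _
      (separatelyWeakStarContinuous_rightExt_leftExt h).1
  refine ((WeakDual.isCompact_closedBall (𝕜 := 𝕜) (0 : StrongDual 𝕜 (StrongDual 𝕜 E)) 1).image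
    hcont).closure_of_subset ?_
  rintro _ ⟨x, hx, rfl⟩
  refine ⟨StrongDual.toWeakDual (NormedSpace.inclusionInDoubleDual 𝕜 E x), ?_, rfl⟩
  rw [mem_closedBall_zero_iff] at hx
  simpa using (NormedSpace.double_dual_bound 𝕜 E x).trans hx

/-- The bidual of a weakly compact operator maps the unit ball into the original space. -/
theorem exists_dualOperator_eq_of_isWeaklyCompactOperator {G : Type*} [NormedAddCommGroup G]
    [NormedSpace 𝕜 G] {T : E →L[𝕜] G} (hT : IsWeaklyCompactOperator T)
    {x'' : StrongDual 𝕜 (StrongDual 𝕜 E)} (hx'' : ‖x''‖ ≤ 1) :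
    ∃ z : G, ∀ g : StrongDual 𝕜 G, x'' (dualOperator T g) = g z := by
  let j : WeakSpace 𝕜 G → WeakDual 𝕜 (StrongDual 𝕜 G) := fun z =>
    StrongDual.toWeakDual (NormedSpace.inclusionInDoubleDual 𝕜 G ((toWeakSpace 𝕜 G).symm z))
  have hj : Continuous j := WeakDual.continuous_of_continuous_eval fun g =>
    WeakBilin.eval_continuous (topDualPairing 𝕜 G).flip g
  let T'' : WeakDual 𝕜 (StrongDual 𝕜 E) → WeakDual 𝕜 (StrongDual 𝕜 G) := fun w =>
    StrongDual.toWeakDual (dualOperator (dualOperator T) (WeakDual.toStrongDual w))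
  have hT'' : Continuous T'' := WeakDual.continuous_of_continuous_eval fun g =>
    WeakDual.eval_continuous (dualOperator T g)
  -- The bidual vectors that `T''` sends into the compact set form a weak-star closed set containing
  -- the ball of `E`; Goldstine then gives the whole bidual ball.
  have hclosed := (IsCompact.image hT hj).isClosed.preimage hT''
  obtain ⟨z, -, hz⟩ := closure_minimal (by
    rintro _ ⟨x, hx, rfl⟩
    exact ⟨_, subset_closure ⟨x, hx, rfl⟩, rfl⟩) hclosed (mem_closure_image_closedBall hx'')
  exact ⟨(toWeakSpace 𝕜 G).symm z, fun g => (DFunLike.congr_fun hz g).symm⟩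

theorem ext_eq_of_isWeaklyCompactOperator {φ : E →L[𝕜] F →L[𝕜] 𝕜}
    (h : IsWeaklyCompactOperator (assocOperator φ)) :
    rightExt (leftExt φ) = leftExt (rightExt φ) := by
  -- The unit ball spans `E''`, so it suffices to compare there.
  refine ContinuousLinearMap.ext_on (s := closedBall 0 1) ?_ fun x'' hx'' => ?_
  · rw [Submodule.eq_top_of_nonempty_interior' _
      ⟨0, mem_interior_iff_mem_nhds.2
        (Filter.mem_of_superset (closedBall_mem_nhds 0 one_pos) Submodule.subset_span)⟩]
    exact dense_univ
  obtain ⟨z, hz⟩ := exists_dualOperator_eq_of_isWeaklyCompactOperator h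
    (mem_closedBall_zero_iff.1 hx'')
  -- Testing on evaluations at points of `F` identifies `z`.
  have hzφ : leftExt φ x'' = z := by
    ext y
    exact hz (NormedSpace.inclusionInDoubleDual 𝕜 F y)
  ext y''
  rw [rightExt_leftExt_apply, leftExt_rightExt_apply, hzφ, hz]

end ArensExt

theorem mainTheorem9 {𝕜 : Type*} [RCLike 𝕜]
    {E : Type*} [NormedAddCommGroup E] [NormedSpace 𝕜 E]
    {F : Type*} [NormedAddCommGroup F] [NormedSpace 𝕜 F]
    (φ : E →L[𝕜] F →L[𝕜] 𝕜) :
    List.TFAE [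
      ArensExt.rightExt (ArensExt.leftExt φ) = ArensExt.leftExt (ArensExt.rightExt φ),
      ∃ ψ : StrongDual 𝕜 (StrongDual 𝕜 E) →L[𝕜] StrongDual 𝕜 (StrongDual 𝕜 F) →L[𝕜] 𝕜,
        ArensExt.SeparatelyWeakStarContinuous ψ ∧ ArensExt.Extends ψ φ,
      ArensExt.IsWeaklyCompactOperator (ArensExt.assocOperator φ)] ∧
    ∀ ψ : StrongDual 𝕜 (StrongDual 𝕜 E) →L[𝕜] StrongDual 𝕜 (StrongDual 𝕜 F) →L[𝕜] 𝕜,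
      ArensExt.SeparatelyWeakStarContinuous ψ → ArensExt.Extends ψ φ →
        ψ = ArensExt.rightExt (ArensExt.leftExt φ) ∧
        ψ = ArensExt.leftExt (ArensExt.rightExt φ) := by
  refine ⟨?_, fun ψ hψ hext =>
    ⟨ArensExt.eq_rightExt_leftExt hψ hext, ArensExt.eq_leftExt_rightExt hψ hext⟩⟩
  tfae_have 1 → 2 := fun h =>
    ⟨_, ArensExt.separatelyWeakStarContinuous_rightExt_leftExt h,
      ArensExt.extends_rightExt_leftExt φ⟩
  tfae_have 2 → 1 := fun ⟨_, hψ, hext⟩ =>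
    (ArensExt.eq_rightExt_leftExt hψ hext).symm.trans (ArensExt.eq_leftExt_rightExt hψ hext)
  tfae_have 1 → 3 := ArensExt.isWeaklyCompactOperator_of_ext_eq
  tfae_have 3 → 1 := ArensExt.ext_eq_of_isWeaklyCompactOperator
  tfae_finish
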